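/- Let $\mathbb{D}$ be the open unit disc and $H(\mathbb{D})$ the space of analytic functions in $\mathbb{D}$. Let $\mu$ be a radial weight, that is, $\mu(z)=\mu(|z|)$ for $z\in\mathbb{D}$, where $\mu:[0,1)\to[0,\infty)$ is integrable and $\widehat{\mu}(z)=\int_{|z|}^1\mu(s)\,ds>0$ for all $z\in\mathbb{D}$. For $f(z)=\sum_{n=0}^\infty\widehat{f}(n)z^n$ in $H(\mathbb{D})$ put $$D^\mu(f)(z)=\sum_{n=0}^\infty\frac{\widehat{f}(n)}{\mu_{2n+1}}z^n,\quad z\in\mathbb{D},\qquad \mu_{2n+1}=\int_0^1r^{2n+1}\mu(r)\,dr,$$ $$\|f\|_{\mathcal{B}^\mu}=\sup_{z\in\mathbb{D}}\widehat{\mu}(z)|D^\mu(f)(z)|,\qquad \|f\|_{\mathcal{B}}=|f(0)|+\sup_{z\in\mathbb{D}}(1-|z|)|f'(z)|,$$ both with values in $[0,\infty]$. Let $\mathcal{B}^\mu$ and $\mathcal{B}$ be the spaces of those $f\in H(\mathbb{D})$ for which $\|f\|_{\mathcal{B}^\mu}<\infty$, respectively $\|f\|_{\mathcal{B}}<\infty$.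 Let $\mathcal{B}^\mu_0$ and $\mathcal{B}_0$ be the spaces of those $f\in H(\mathbb{D})$ for which $\lim_{|z|\to1^-}\widehat{\mu}(z)|D^\mu(f)(z)|=0$, respectively $\lim_{|z|\to1^-}(1-|z|^2)|f'(z)|=0$. Then $\mathcal{B}^\mu$ is continuously embedded in $\mathcal{B}$: $\mathcal{B}^\mu\subset\mathcal{B}$ and there is a constant $C=C(\mu)>0$ such that $\|f\|_{\mathcal{B}}\le C\|f\|_{\mathcal{B}^\mu}$ for all $f\in H(\mathbb{D})$. Moreover, $\mathcal{B}_0^\mu\subset\mathcal{B}^\mu$ and $\mathcal{B}_0\subset\mathcal{B}$, and with the norms inherited from $\mathcal{B}^\mu$ and $\mathcal{B}$, $\mathcal{B}_0^\mu$ is continuously embedded in $\mathcal{B}_0$: $\mathcal{B}_0^\mu\subset\mathcal{B}_0$ and there is a constant $C=C(\mu)>0$ such that $\|f\|_{\mathcal{B}}\le C\|f\|_{\mathcal{B}^\mu}$ for all $f\in\mathcal{B}_0^\mu$. -/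

import Mathlib

open MeasureTheory Set Filter Topology
open scoped NNReal ENNReal

namespace FracBloch

/-- The open unit disc of the complex plane. -/
def disc : Set ℂ := Metric.ball (0 : ℂ) 1

/-- Analytic functions in the unit disc: functions on `ℂ` that are holomorphic on the open disc.
Nothing below uses their values off the disc. -/
def HolDisc : Set (ℂ → ℂ) := {f | DifferentiableOn ℂ f disc}

/-- `μ : ℝ → ℝ` is the profile of a radial weight `z ↦ μ |z|`: it is nonnegative and integrable on
`[0, 1)`, and `∫_r^1 μ > 0` for all `0 ≤ r < 1`. -/
structure IsRadialWeight (μ : ℝ → ℝ) : Prop where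
  nonneg : ∀ r ∈ Ico (0 : ℝ) 1, 0 ≤ μ r
  integrable : IntegrableOn μ (Ico (0 : ℝ) 1)
  tail_pos : ∀ r ∈ Ico (0 : ℝ) 1, 0 < ∫ s in r..1, μ s

/-- The tail `μ̂(z) = ∫_{|z|}^1 μ(s) ds`. -/
noncomputable def tail (μ : ℝ → ℝ) (z : ℂ) : ℝ := ∫ s in ‖z‖..1, μ s

/-- The moment `μ_n = ∫_0^1 r^n μ(r) dr`. -/
noncomputable def moment (μ : ℝ → ℝ) (n : ℕ) : ℝ := ∫ r in (0 : ℝ)..1, r ^ n * μ r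

/-- The `n`-th Maclaurin coefficient of `f`. -/
noncomputable def coeff (f : ℂ → ℂ) (n : ℕ) : ℂ := iteratedDeriv n f 0 / (n.factorial : ℂ)

/-- The fractional derivative `D^μ f(z) = ∑ f̂(n) / μ_{2n+1} z^n`. -/
noncomputable def fracDeriv (μ : ℝ → ℝ) (f : ℂ → ℂ) (z : ℂ) : ℂ :=
  ∑' n : ℕ, coeff f n / (moment μ (2 * n + 1) : ℂ) * z ^ n

/-- `‖f‖_{𝓑^μ} = sup_{z ∈ 𝔻} μ̂(z) |D^μ f(z)|`, with values in `[0, ∞]`. -/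
noncomputable def fracBlochNorm (μ : ℝ → ℝ) (f : ℂ → ℂ) : ℝ≥0∞ :=
  ⨆ z ∈ disc, ENNReal.ofReal (tail μ z * ‖fracDeriv μ f z‖)

/-- `‖f‖_𝓑 = |f(0)| + sup_{z ∈ 𝔻} (1 - |z|) |f'(z)|`, with values in `[0, ∞]`. -/
noncomputable def blochNorm (f : ℂ → ℂ) : ℝ≥0∞ :=
  ENNReal.ofReal ‖f 0‖ + ⨆ z ∈ disc, ENNReal.ofReal ((1 - ‖z‖) * ‖deriv f z‖)

/-- The space `𝓑^μ`. -/
def FracBlochSpace (μ : ℝ → ℝ) : Set (ℂ → ℂ) := {f | f ∈ HolDisc ∧ fracBlochNorm μ f < ∞}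

/-- The Bloch space `𝓑`. -/
def BlochSpace : Set (ℂ → ℂ) := {f | f ∈ HolDisc ∧ blochNorm f < ∞}

/-- The filter `|z| → 1⁻`. -/
noncomputable def toBoundary : Filter ℂ := comap (fun z : ℂ => ‖z‖) (𝓝[<] (1 : ℝ))

/-- The little space `𝓑₀^μ`, carrying the norm of `𝓑^μ`. -/
def LittleFracBlochSpace (μ : ℝ → ℝ) : Set (ℂ → ℂ) :=
  {f | f ∈ HolDisc ∧ Tendsto (fun z => tail μ z * ‖fracDeriv μ f z‖) toBoundary (𝓝 0)}

/-- The little Bloch space `𝓑₀`, carrying the norm of `𝓑`. -/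
def LittleBlochSpace : Set (ℂ → ℂ) :=
  {f | f ∈ HolDisc ∧ Tendsto (fun z => (1 - ‖z‖ ^ 2) * ‖deriv f z‖) toBoundary (𝓝 0)}

theorem pow_mul_tail_le_moment {μ : ℝ → ℝ} (hμ : IsRadialWeight μ) {ε : ℝ} (h0 : 0 ≤ ε)
    (h1 : ε < 1) (n : ℕ) : ε ^ n * (∫ s in ε..1, μ s) ≤ moment μ n := by
  have hInt : IntervalIntegrable μ volume 0 1 := by
    rw [intervalIntegrable_iff_integrableOn_Ico_of_le zero_le_one]
    exact hμ.integrable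
  have hInt2 : IntervalIntegrable (fun r => r ^ n * μ r) volume 0 1 :=
    hInt.continuousOn_mul (by fun_prop)
  have hs1 : uIcc 0 ε ⊆ uIcc (0 : ℝ) 1 := by
    rw [uIcc_of_le h0, uIcc_of_le zero_le_one]; exact Icc_subset_Icc_right h1.le
  have hs2 : uIcc ε 1 ⊆ uIcc (0 : ℝ) 1 := by
    rw [uIcc_of_le h1.le, uIcc_of_le zero_le_one]; exact Icc_subset_Icc_left h0
  have hsplit := intervalIntegral.integral_add_adjacent_intervals
    (hInt2.mono_set hs1) (hInt2.mono_set hs2)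
  have hA : 0 ≤ ∫ r in (0 : ℝ)..ε, r ^ n * μ r :=
    intervalIntegral.integral_nonneg h0 fun r hr =>
      mul_nonneg (pow_nonneg hr.1 n) (hμ.nonneg r ⟨hr.1, hr.2.trans_lt h1⟩)
  have hB : (∫ r in ε..1, ε ^ n * μ r) ≤ ∫ r in ε..1, r ^ n * μ r := by
    refine intervalIntegral.integral_mono_on_of_le_Ioo h1.le
      ((hInt.mono_set hs2).const_mul _) (hInt2.mono_set hs2) fun r hr => ?_
    exact mul_le_mul_of_nonneg_right (pow_le_pow_left₀ h0 hr.1.le n)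
      (hμ.nonneg r ⟨h0.trans hr.1.le, hr.2⟩)
  rw [intervalIntegral.integral_const_mul] at hB
  unfold moment
  linarith

/-- The series that defines `D^μ f` converges on the disc. -/
theorem summable_fracDeriv {μ : ℝ → ℝ} (hμ : IsRadialWeight μ) {f : ℂ → ℂ} (hf : f ∈ HolDisc)
    {z : ℂ} (hz : z ∈ disc) :
    Summable fun n : ℕ => coeff f n / (moment μ (2 * n + 1) : ℂ) * z ^ n := by
  have hz1 : ‖z‖ < 1 := by simpa [disc] using hz
  obtain ⟨q, hq1, hq2⟩ := exists_between hz1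
  have hq0 : 0 < q := (norm_nonneg z).trans_lt hq1
  set ε := Real.sqrt q
  have hε0 : 0 < ε := Real.sqrt_pos.2 hq0
  have hε1 : ε < 1 := by rw [Real.sqrt_lt' one_pos]; simpa using hq2
  have hεq : ε ^ 2 = q := Real.sq_sqrt hq0.le
  have hT := hμ.tail_pos ε ⟨hε0.le, hε1⟩
  set T := ∫ s in ε..1, μ s
  have hw : ((‖z‖ / q : ℝ) : ℂ) ∈ Metric.ball (0 : ℂ) 1 := by
    rw [mem_ball_zero_iff, Complex.norm_real, Real.norm_of_nonneg (by positivity), div_lt_one hq0]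
    exact hq1
  have hs := (Complex.hasSum_taylorSeries_on_ball (r := 1) hf hw).summable.norm
  refine Summable.of_norm_bounded (hs.mul_left (1 / (ε * T))) fun n => ?_
  have hm := pow_mul_tail_le_moment hμ hε0.le hε1 (2 * n + 1)
  have hp : ε ^ (2 * n + 1) = q ^ n * ε := by rw [pow_succ, pow_mul, hεq]
  rw [hp] at hm
  have hpos : 0 < q ^ n * ε * T := by positivity
  have hc : ‖(moment μ (2 * n + 1) : ℂ)‖ = moment μ (2 * n + 1) := by
    rw [Complex.norm_real, Real.norm_of_nonneg (hpos.le.trans hm)]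
  have hr : ‖((n.factorial : ℂ)⁻¹ • (((‖z‖ / q : ℝ) : ℂ) - 0) ^ n • iteratedDeriv n f 0)‖
      = ‖coeff f n‖ * (‖z‖ ^ n / q ^ n) := by
    rw [sub_zero, norm_smul, norm_smul, norm_pow, Complex.norm_real,
      Real.norm_of_nonneg (by positivity), div_pow, coeff, norm_div, norm_inv]
    ring
  rw [hr, norm_mul, norm_div, hc, norm_pow]
  calc ‖coeff f n‖ / moment μ (2 * n + 1) * ‖z‖ ^ n
      ≤ ‖coeff f n‖ / (q ^ n * ε * T) * ‖z‖ ^ n := by gcongr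
    _ = 1 / (ε * T) * (‖coeff f n‖ * (‖z‖ ^ n / q ^ n)) := by field_simp

end FracBloch

/-! Write `g = D^μ f`. Since the moments undo the division in `g`, termwise integration gives `f'(z)
= ∫₀¹ r³ μ(r) g'(r² z) dr` (`deriv_eq_integral`). If `|g| ≤ N / μ̂(ρ)` on `|ζ| ≤ ρ`, the Cauchy
estimate with `ρ = (r + r²|z|)/2` bounds the integrand by `2N μ(r) / ((1 - r|z|) μ̂(ρ))`. No
doubling condition relates `μ̂(ρ)` to `μ̂(r)`, so the range of `r` is cut into pieces `S ⊆ [a, 1)`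
short enough that `ρ ≤ a` for every `r` in `S`. Then `∫_S μ ≤ μ̂(a) ≤ μ̂(ρ)`, the weight cancels,
and `S` contributes at most `2N / inf_S (1 - r|z|)` (`lintegral_cauchy_piece_le`). With one piece
next to 1 and geometric shells in `1 - r`, these sum to `O(N / (1 - |z|))` (`norm_deriv_le`). For
the little spaces, `N` may be taken arbitrarily small once `ρ` is near 1; the remaining `r` give a
bounded term, killed by the factor `1 - |z|`. -/

namespace FracBloch

/-! ### Power series on the disc. -/

theorem mem_disc {z : ℂ} : z ∈ disc ↔ ‖z‖ < 1 := by simp [disc]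

theorem isOpen_disc : IsOpen disc := Metric.isOpen_ball

theorem hasFPowerSeriesOnBall_tsum {c : ℕ → ℂ} (hc : ∀ z ∈ disc, Summable fun n => c n * z ^ n) :
    HasFPowerSeriesOnBall (fun z => ∑' n, c n * z ^ n)
      (FormalMultilinearSeries.ofScalars ℂ c) 0 1 := by
  have hr : 1 ≤ (FormalMultilinearSeries.ofScalars ℂ c).radius := by
    refine ENNReal.le_of_forall_nnreal_lt fun r hr => ?_
    refine FormalMultilinearSeries.le_radius_of_summable _ ?_
    have hr1 : (r : ℝ) < 1 := by exact_mod_cast hr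
    have h := (hc ((r : ℝ) : ℂ) (mem_disc.2 (by simpa using hr1))).norm
    simpa [FormalMultilinearSeries.ofScalars_norm] using h
  have hs : (FormalMultilinearSeries.ofScalars ℂ c).sum = fun z => ∑' n, c n * z ^ n := by
    ext z
    exact (FormalMultilinearSeries.ofScalars_sum_eq c z).trans (by simp)
  rw [← hs]
  exact ((FormalMultilinearSeries.ofScalars ℂ c).hasFPowerSeriesOnBall
    (one_pos.trans_le hr)).mono one_pos hr

theorem tsum_mem_holDisc {c : ℕ → ℂ} (hc : ∀ z ∈ disc, Summable fun n => c n * z ^ n) :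
    (fun z => ∑' n, c n * z ^ n) ∈ HolDisc := by
  have h := (hasFPowerSeriesOnBall_tsum hc).differentiableOn
  have hb : Metric.eball (0 : ℂ) 1 = disc := by
    rw [disc, ← ENNReal.ofReal_one, Metric.eball_ofReal]
  rwa [hb] at h

theorem coeff_tsum {c : ℕ → ℂ} (hc : ∀ z ∈ disc, Summable fun n => c n * z ^ n) (n : ℕ) :
    coeff (fun z => ∑' n, c n * z ^ n) n = c n := by
  have h := (hasFPowerSeriesOnBall_tsum hc).hasFPowerSeriesAt
  have h2 := h.analyticAt.hasFPowerSeriesAt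
  exact congrFun (FormalMultilinearSeries.ofScalars_series_injective ℂ ℂ
    (h2.eq_formalMultilinearSeries h)) n

theorem deriv_mem_holDisc {f : ℂ → ℂ} (hf : f ∈ HolDisc) : deriv f ∈ HolDisc :=
  DifferentiableOn.deriv hf isOpen_disc

theorem hasSum_deriv {f : ℂ → ℂ} (hf : f ∈ HolDisc) {z : ℂ} (hz : z ∈ disc) :
    HasSum (fun n : ℕ => ((n : ℂ) + 1) * coeff f (n + 1) * z ^ n) (deriv f z) := by
  have h := Complex.hasSum_taylorSeries_on_ball (r := 1) (deriv_mem_holDisc hf) hz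
  refine (funext fun n => ?_ : (fun n : ℕ => ((n : ℂ) + 1) * coeff f (n + 1) * z ^ n) = _) ▸ h
  have h1 : ((n.factorial : ℕ) : ℂ) ≠ 0 := by exact_mod_cast n.factorial_ne_zero
  have h2 : (n : ℂ) + 1 ≠ 0 := by exact_mod_cast n.succ_ne_zero
  rw [coeff, iteratedDeriv_succ', Nat.factorial_succ, sub_zero, smul_eq_mul, smul_eq_mul]
  push_cast
  field_simp

/-! ### Moments and the integral formula for `f'`. -/

namespace IsRadialWeight

variable {μ : ℝ → ℝ} (hμ : IsRadialWeight μ)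
include hμ

theorem moment_pos (n : ℕ) : 0 < moment μ n := by
  have h := hμ.tail_pos (1 / 2) ⟨by norm_num, by norm_num⟩
  exact (by positivity : 0 < (1 / 2 : ℝ) ^ n * ∫ s in (1 / 2 : ℝ)..1, μ s).trans_le
    (pow_mul_tail_le_moment hμ (by norm_num) (by norm_num) n)

theorem integrableOn_Ioo {a : ℝ} (ha : 0 ≤ a) : IntegrableOn μ (Ioo a 1) :=
  hμ.integrable.mono_set fun _ hr => ⟨ha.trans hr.1.le, hr.2⟩

theorem fracDeriv_mem_holDisc {f : ℂ → ℂ} (hf : f ∈ HolDisc) : fracDeriv μ f ∈ HolDisc :=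
  tsum_mem_holDisc fun _ hz => summable_fracDeriv hμ hf hz

theorem coeff_fracDeriv {f : ℂ → ℂ} (hf : f ∈ HolDisc) (n : ℕ) :
    coeff (fracDeriv μ f) n = coeff f n / (moment μ (2 * n + 1) : ℂ) :=
  coeff_tsum (fun _ hz => summable_fracDeriv hμ hf hz) n

theorem integrable_pow_mul (n : ℕ) : IntegrableOn (fun r => r ^ n * μ r) (Ioo 0 1) := by
  refine (hμ.integrableOn_Ioo le_rfl).bdd_mul (c := 1)
    (by fun_prop) ?_
  filter_upwards [ae_restrict_mem measurableSet_Ioo] with r hr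
  rw [norm_pow, Real.norm_of_nonneg hr.1.le]
  exact pow_le_one₀ hr.1.le hr.2.le

theorem deriv_eq_integral {f : ℂ → ℂ} (hf : f ∈ HolDisc) {z : ℂ} (hz : z ∈ disc) :
    deriv f z = ∫ r in Ioo (0 : ℝ) 1,
      ((r ^ 3 * μ r : ℝ) : ℂ) * deriv (fracDeriv μ f) ((r : ℂ) ^ 2 * z) := by
  -- Differentiation shifts the index, so the power is `2(n + 1) + 1 = 2n + 3`, which splits as `r³
  -- · (r²)ⁿ`.
  set F : ℕ → ℝ → ℂ := fun n r => (((n : ℂ) + 1) *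
    (coeff f (n + 1) / (moment μ (2 * (n + 1) + 1) : ℂ)) * z ^ n) *
      ((r ^ (2 * (n + 1) + 1) * μ r : ℝ) : ℂ) with hF
  have hmom : ∀ n : ℕ, ∫ r in Ioo (0 : ℝ) 1, r ^ n * μ r = moment μ n := fun n => by
    rw [moment, intervalIntegral.integral_of_le zero_le_one, integral_Ioc_eq_integral_Ioo]
  have hInt : ∀ n, Integrable (F n) (volume.restrict (Ioo 0 1)) := fun n =>
    (hμ.integrable_pow_mul (2 * (n + 1) + 1)).ofReal.const_mul _
  have hval : ∀ n, ∫ r in Ioo (0 : ℝ) 1, F n r = ((n : ℂ) + 1) * coeff f (n + 1) * z ^ n := by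
    intro n
    have h0 : (moment μ (2 * (n + 1) + 1) : ℂ) ≠ 0 := by
      exact_mod_cast (hμ.moment_pos (2 * (n + 1) + 1)).ne'
    simp only [hF]
    rw [integral_const_mul, integral_complex_ofReal, hmom]
    field_simp
  have hnorm : ∀ n, ∫ r in Ioo (0 : ℝ) 1, ‖F n r‖
      = ‖((n : ℂ) + 1) * coeff f (n + 1) * z ^ n‖ := by
    intro n
    have h0 := hμ.moment_pos (2 * (n + 1) + 1)
    have h1 : ∫ r in Ioo (0 : ℝ) 1, ‖F n r‖ = ∫ r in Ioo (0 : ℝ) 1, ‖((n : ℂ) + 1) *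
        (coeff f (n + 1) / (moment μ (2 * (n + 1) + 1) : ℂ)) * z ^ n‖ *
          (r ^ (2 * (n + 1) + 1) * μ r) := by
      refine setIntegral_congr_fun measurableSet_Ioo fun r hr => ?_
      have h2 := hμ.nonneg r ⟨hr.1.le, hr.2⟩
      have h3 := hr.1.le
      simp only [hF]
      rw [norm_mul, Complex.norm_real, Real.norm_of_nonneg (by positivity)]
    rw [h1, integral_const_mul, hmom]
    simp only [norm_mul, norm_div, Complex.norm_real, Real.norm_of_nonneg h0.le]
    field_simp
  -- The moments cancel in the integrals of norms too, leaving the absolutely convergent Taylor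
  -- series of `f'`.
  have hsum := hasSum_integral_of_summable_integral_norm hInt
    (by simpa only [hnorm] using (hasSum_deriv hf hz).summable.norm)
  simp only [hval] at hsum
  rw [(hasSum_deriv hf hz).unique hsum]
  refine setIntegral_congr_fun measurableSet_Ioo fun r hr => ?_
  have hw : (r : ℂ) ^ 2 * z ∈ disc := by
    rw [mem_disc] at hz ⊢
    rw [norm_mul, norm_pow, Complex.norm_real, Real.norm_of_nonneg hr.1.le]
    exact (mul_le_of_le_one_left (norm_nonneg _) (pow_le_one₀ hr.1.le hr.2.le)).trans_lt hz
  have h := (hasSum_deriv (hμ.fracDeriv_mem_holDisc hf) hw).mul_left ((r ^ 3 * μ r : ℝ) : ℂ)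
  rw [← h.tsum_eq]
  refine tsum_congr fun n => ?_
  simp only [hF]
  rw [hμ.coeff_fracDeriv hf]
  push_cast
  ring

end IsRadialWeight

/-! ### Cauchy estimates against the tail of the weight. -/

theorem norm_deriv_le_div_sub {g : ℂ → ℂ} (hg : g ∈ HolDisc) {w : ℂ} {ρ B : ℝ} (hw : ‖w‖ < ρ)
    (hρ : ρ < 1) (hB : ∀ ζ : ℂ, ‖ζ‖ ≤ ρ → ‖g ζ‖ ≤ B) : ‖deriv g w‖ ≤ B / (ρ - ‖w‖) := by
  have hsub : Metric.closedBall w (ρ - ‖w‖) ⊆ Metric.closedBall 0 ρ :=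
    Metric.closedBall_subset_closedBall' (by rw [dist_zero_right]; linarith)
  refine Complex.norm_deriv_le_of_forall_mem_sphere_norm_le (sub_pos.2 hw) ?_ fun ζ hζ =>
    hB ζ (by simpa using hsub (Metric.sphere_subset_closedBall hζ))
  refine DifferentiableOn.diffContOnCl_ball (U := disc) hg ?_
  exact hsub.trans (Metric.closedBall_subset_ball hρ)

namespace IsRadialWeight

variable {μ : ℝ → ℝ} (hμ : IsRadialWeight μ)
include hμ

theorem intervalIntegrable : IntervalIntegrable μ volume 0 1 := by
  rw [intervalIntegrable_iff_integrableOn_Ico_of_le zero_le_one]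
  exact hμ.integrable

theorem integral_tail_anti {a b : ℝ} (ha : 0 ≤ a) (hab : a ≤ b) (hb : b ≤ 1) :
    ∫ s in b..1, μ s ≤ ∫ s in a..1, μ s := by
  have h1 : IntervalIntegrable μ volume a b := hμ.intervalIntegrable.mono_set (by
    rw [uIcc_of_le hab, uIcc_of_le zero_le_one]; exact Icc_subset_Icc ha hb)
  have h2 : IntervalIntegrable μ volume b 1 := hμ.intervalIntegrable.mono_set (by
    rw [uIcc_of_le hb, uIcc_of_le zero_le_one]; exact Icc_subset_Icc_left (ha.trans hab))
  rw [← intervalIntegral.integral_add_adjacent_intervals h1 h2, le_add_iff_nonneg_left,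
    intervalIntegral.integral_of_le hab, integral_Ioc_eq_integral_Ioo]
  exact setIntegral_nonneg measurableSet_Ioo fun r hr =>
    hμ.nonneg r ⟨ha.trans hr.1.le, hr.2.trans_le hb⟩

theorem lintegral_Ioo_eq_tail {a : ℝ} (h0 : 0 ≤ a) (h1 : a ≤ 1) :
    ∫⁻ r in Ioo a 1, ENNReal.ofReal (μ r) = ENNReal.ofReal (∫ s in a..1, μ s) := by
  rw [intervalIntegral.integral_of_le h1, integral_Ioc_eq_integral_Ioo,
    ofReal_integral_eq_lintegral_ofReal (hμ.integrableOn_Ioo h0)]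
  filter_upwards [ae_restrict_mem measurableSet_Ioo] with r hr
  exact hμ.nonneg r ⟨h0.trans hr.1.le, hr.2⟩

theorem tendsto_integral_tail : Tendsto (fun r => ∫ s in r..1, μ s) (𝓝[<] 1) (𝓝 0) := by
  have h1 : IntegrableOn μ (uIcc 0 1) := by
    rw [uIcc_of_le zero_le_one, integrableOn_Icc_iff_integrableOn_Ico]
    exact hμ.integrable
  have h := intervalIntegral.continuousOn_primitive_interval_left h1 1 right_mem_uIcc
  rw [ContinuousWithinAt, intervalIntegral.integral_same, uIcc_of_le zero_le_one] at h
  refine h.mono_left (nhdsWithin_le_of_mem ?_)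
  exact mem_of_superset (Ioo_mem_nhdsLT one_pos) Ioo_subset_Icc_self

/-- The Cauchy estimate on the disc of radius `(r + r² |z|) / 2`. -/
theorem norm_mul_deriv_le {g : ℂ → ℂ} (hg : g ∈ HolDisc) {N R : ℝ} (hN : 0 ≤ N)
    (H : ∀ ρ, R ≤ ρ → ρ < 1 → ∀ ζ : ℂ, ‖ζ‖ ≤ ρ → ‖g ζ‖ ≤ N / ∫ s in ρ..1, μ s)
    {z : ℂ} {r a m : ℝ} (hr : r ∈ Ioo (0 : ℝ) 1) (hR : R ≤ r ^ 2 * ‖z‖)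
    (hra : (r + r ^ 2 * ‖z‖) / 2 ≤ a) (ha : a < 1) (hm : 0 < m) (hmr : m ≤ 1 - r * ‖z‖) :
    ‖((r ^ 3 * μ r : ℝ) : ℂ) * deriv g ((r : ℂ) ^ 2 * z)‖
      ≤ 2 * N / (m * ∫ s in a..1, μ s) * μ r := by
  obtain ⟨hr0, hr1⟩ := hr
  have hx := norm_nonneg z
  set x := ‖z‖
  have hμr := hμ.nonneg r ⟨hr0.le, hr1⟩
  have hw : ‖(r : ℂ) ^ 2 * z‖ = r ^ 2 * x := by
    rw [norm_mul, norm_pow, Complex.norm_real, Real.norm_of_nonneg hr0.le]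
  -- The factor `r` in this gap is absorbed by `r³`, so nothing blows up as `r → 0`.
  have hgap : (r + r ^ 2 * x) / 2 - r ^ 2 * x = r * (1 - r * x) / 2 := by ring
  have hrx : 0 < 1 - r * x := hm.trans_le hmr
  have hgap0 : 0 < r * (1 - r * x) / 2 := by positivity
  have hρ0 : 0 ≤ (r + r ^ 2 * x) / 2 := by positivity
  have hT := hμ.tail_pos a ⟨hρ0.trans hra, ha⟩
  set T := ∫ s in a..1, μ s
  have hd := norm_deriv_le_div_sub hg (w := (r : ℂ) ^ 2 * z) (ρ := (r + r ^ 2 * x) / 2)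
    (B := N / T) (by rw [hw]; linarith) (hra.trans_lt ha) fun ζ hζ =>
      (H _ (by linarith) (hra.trans_lt ha) ζ hζ).trans
        (div_le_div_of_nonneg_left hN hT (hμ.integral_tail_anti hρ0 hra ha.le))
  rw [hw, hgap] at hd
  rw [norm_mul, Complex.norm_real, Real.norm_of_nonneg (by positivity)]
  calc r ^ 3 * μ r * ‖deriv g ((r : ℂ) ^ 2 * z)‖
      ≤ r ^ 3 * μ r * (N / T / (r * (1 - r * x) / 2)) := by gcongr
    _ = r ^ 2 * (2 * N / ((1 - r * x) * T) * μ r) := by field_simp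
    _ ≤ 1 * (2 * N / ((1 - r * x) * T) * μ r) := by
        gcongr
        exact pow_le_one₀ hr0.le hr1.le
    _ ≤ 2 * N / (m * T) * μ r := by rw [one_mul]; gcongr

theorem lintegral_enorm_le_of_le_mul {G : ℝ → ℂ} {S : Set ℝ} (hS : MeasurableSet S) {a b c : ℝ}
    (h0 : 0 ≤ a) (h1 : a ≤ 1) (hc : 0 ≤ c) (hSa : S ⊆ Ico a 1)
    (hG : ∀ r ∈ S, ‖G r‖ ≤ c * μ r) (hb : c * (∫ s in a..1, μ s) ≤ b) :
    ∫⁻ r in S, ‖G r‖ₑ ≤ ENNReal.ofReal b :=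
  calc ∫⁻ r in S, ‖G r‖ₑ
      ≤ ∫⁻ r in S, ENNReal.ofReal c * ENNReal.ofReal (μ r) := by
        refine setLIntegral_mono' hS fun r hr => ?_
        rw [← ENNReal.ofReal_mul hc, ← ofReal_norm]
        exact ENNReal.ofReal_le_ofReal (hG r hr)
    _ ≤ ∫⁻ r in Ico a 1, ENNReal.ofReal c * ENNReal.ofReal (μ r) := lintegral_mono_set hSa
    _ = ENNReal.ofReal c * ENNReal.ofReal (∫ s in a..1, μ s) := by
        rw [lintegral_const_mul' _ _ ENNReal.ofReal_ne_top, ← hμ.lintegral_Ioo_eq_tail h0 h1,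
          restrict_Ioo_eq_restrict_Ico]
    _ ≤ ENNReal.ofReal b := by
        rw [← ENNReal.ofReal_mul hc]
        exact ENNReal.ofReal_le_ofReal hb

/-- The Cauchy bound carries `1 / μ̂(a)` and the mass of `μ` on `S` is at most `μ̂(a)`, so the
result does not depend on the weight. -/
theorem lintegral_cauchy_piece_le {g : ℂ → ℂ} (hg : g ∈ HolDisc) {N R : ℝ} (hN : 0 ≤ N)
    (H : ∀ ρ, R ≤ ρ → ρ < 1 → ∀ ζ : ℂ, ‖ζ‖ ≤ ρ → ‖g ζ‖ ≤ N / ∫ s in ρ..1, μ s)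
    {z : ℂ} {a m : ℝ} (ha0 : 0 < a) (ha : a < 1) (hm : 0 < m)
    {S : Set ℝ} (hS : MeasurableSet S) (hSa : S ⊆ Ico a 1)
    (hSr : ∀ r ∈ S, R ≤ r ^ 2 * ‖z‖ ∧ (r + r ^ 2 * ‖z‖) / 2 ≤ a ∧ m ≤ 1 - r * ‖z‖) :
    ∫⁻ r in S, ‖((r ^ 3 * μ r : ℝ) : ℂ) * deriv g ((r : ℂ) ^ 2 * z)‖ₑ
      ≤ ENNReal.ofReal (2 * N / m) := by
  have hT := hμ.tail_pos a ⟨ha0.le, ha⟩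
  refine hμ.lintegral_enorm_le_of_le_mul hS ha0.le ha.le (c := 2 * N / (m * ∫ s in a..1, μ s))
    (by positivity) hSa (fun r hr => ?_) ?_
  · obtain ⟨h1, h2, h3⟩ := hSr r hr
    exact hμ.norm_mul_deriv_le hg hN H ⟨ha0.trans_le (hSa hr).1, (hSa hr).2⟩ h1 h2 ha hm h3
  · exact le_of_eq (by field_simp)

/-! ### The pointwise bound for `f'`. -/

/-- Growth of `D^μ f` is controlled only from radius `R` on, so that one statement serves both
spaces: `R = 0`, `r₀ = 1/2` for the Bloch bound, and `R`, `r₀` near 1 with small `N` for the little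
spaces. -/
theorem norm_deriv_le {f : ℂ → ℂ} (hf : f ∈ HolDisc) {N R K r₀ : ℝ} (hN : 0 ≤ N)
    (H : ∀ ρ, R ≤ ρ → ρ < 1 → ∀ ζ : ℂ, ‖ζ‖ ≤ ρ → ‖fracDeriv μ f ζ‖ ≤ N / ∫ s in ρ..1, μ s)
    (hr₀ : 1 / 2 ≤ r₀) (hr₁ : r₀ < 1)
    (hK : ∀ w : ℂ, ‖w‖ ≤ r₀ ^ 2 → ‖deriv (fracDeriv μ f) w‖ ≤ K)
    {z : ℂ} (hz : ‖z‖ < 1) (hR : R ≤ r₀ ^ 2 * ‖z‖) :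
    ‖deriv f z‖ ≤ K * (∫ s in (0 : ℝ)..1, μ s) + 42 * N / (1 - ‖z‖) := by
  have hg := hμ.fracDeriv_mem_holDisc hf
  have hx := norm_nonneg z
  have hK0 : 0 ≤ K := (norm_nonneg _).trans (hK 0 (by rw [norm_zero]; positivity))
  have hT0 := hμ.tail_pos 0 ⟨le_rfl, one_pos⟩
  rw [hμ.deriv_eq_integral hf (mem_disc.2 hz)]
  set G : ℝ → ℂ := fun r => ((r ^ 3 * μ r : ℝ) : ℂ) * deriv (fracDeriv μ f) ((r : ℂ) ^ 2 * z)
  set x := ‖z‖ with hxdef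
  set h := (1 - x) / 4 with hh
  have hh0 : 0 < h := by rw [hh]; linarith
  have hlam : ∀ k : ℕ, 0 < (5 / 4 : ℝ) ^ k * h := fun k => by positivity
  -- Shells `(5/4)^k h ≤ 1 - r ≤ (5/4)^(k+1) h`, truncated at `r₀`.
  set S : ℕ → Set ℝ := fun k => Icc (max r₀ (1 - (5 / 4) ^ (k + 1) * h)) (1 - (5 / 4) ^ k * h)
  have hRr : ∀ r, r₀ ≤ r → R ≤ r ^ 2 * x := fun r hr => hR.trans (by gcongr)
  have hcover : Ioo (0 : ℝ) 1 ⊆ (Ioo 0 r₀ ∪ Ico (max r₀ (1 - h)) 1) ∪ ⋃ k, S k := by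
    rintro r ⟨h0, h1⟩
    rcases lt_or_ge r r₀ with h2 | h2
    · exact Or.inl (Or.inl ⟨h0, h2⟩)
    rcases le_or_gt (1 - h) r with h3 | h3
    · exact Or.inl (Or.inr ⟨max_le h2 h3, h1⟩)
    have h4 : 1 ≤ (1 - r) / h := by rw [le_div_iff₀ hh0]; linarith
    obtain ⟨k, hk1, hk2⟩ := exists_nat_pow_near h4 (by norm_num : (1 : ℝ) < 5 / 4)
    rw [le_div_iff₀ hh0] at hk1
    rw [div_lt_iff₀ hh0] at hk2
    exact Or.inr (mem_iUnion.2 ⟨k, max_le h2 (by linarith), by linarith⟩)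
  have hsmall : ∫⁻ r in Ioo 0 r₀, ‖G r‖ₑ ≤ ENNReal.ofReal (K * ∫ s in (0 : ℝ)..1, μ s) := by
    refine hμ.lintegral_enorm_le_of_le_mul measurableSet_Ioo le_rfl zero_le_one hK0
      (fun r hr => ⟨hr.1.le, hr.2.trans hr₁⟩) (fun r hr => ?_) le_rfl
    have h1 := hμ.nonneg r ⟨hr.1.le, hr.2.trans hr₁⟩
    have h2 : ‖(r : ℂ) ^ 2 * z‖ ≤ r₀ ^ 2 := by
      rw [norm_mul, norm_pow, Complex.norm_real, Real.norm_of_nonneg hr.1.le]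
      calc r ^ 2 * x ≤ r₀ ^ 2 * 1 := by
            gcongr
            · exact hr.1.le
            · exact hr.2.le
        _ = r₀ ^ 2 := mul_one _
    have h3 := hr.1.le
    have h4 : r ^ 3 ≤ 1 := pow_le_one₀ h3 (hr.2.trans hr₁).le
    simp only [G]
    rw [norm_mul, Complex.norm_real, Real.norm_of_nonneg (by positivity)]
    calc r ^ 3 * μ r * ‖deriv (fracDeriv μ f) ((r : ℂ) ^ 2 * z)‖ ≤ 1 * μ r * K := by
          gcongr
          exact hK _ h2
      _ = K * μ r := by ring
  have hfirst : ∫⁻ r in Ico (max r₀ (1 - h)) 1, ‖G r‖ₑ ≤ ENNReal.ofReal (2 * N / (1 - x)) := by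
    refine hμ.lintegral_cauchy_piece_le hg hN H (lt_max_of_lt_left (by linarith))
      (max_lt hr₁ (by linarith)) (by linarith) measurableSet_Ico subset_rfl fun r hr => ?_
    have h1 : r₀ ≤ r := (le_max_left _ _).trans hr.1
    refine ⟨hRr r h1, le_max_of_le_right ?_, ?_⟩
    -- Here `(r + r²x)/2 ≤ (1 + x)/2 = 1 - 2h`.
    · rw [hh]
      nlinarith [hr.2, mul_nonneg (sub_nonneg.2 hr.2.le) (by linarith : 0 ≤ r),
        mul_nonneg (sub_nonneg.2 hr.2.le) (mul_nonneg (by linarith : 0 ≤ r) hx)]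
    · nlinarith [hr.2, mul_nonneg (sub_nonneg.2 hr.2.le) hx]
  have hpiece : ∀ k, ∫⁻ r in S k, ‖G r‖ₑ ≤ ENNReal.ofReal (2 * N / ((5 / 4) ^ k * h)) := by
    intro k
    have hk := hlam k
    have hk1 := hlam (k + 1)
    refine hμ.lintegral_cauchy_piece_le hg hN H (lt_max_of_lt_left (by linarith))
      (max_lt hr₁ (by linarith)) hk measurableSet_Icc
      (fun r hr => ⟨hr.1, hr.2.trans_lt (by linarith)⟩) fun r hr => ?_
    have h1 : r₀ ≤ r := (le_max_left _ _).trans hr.1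
    have h2 := hr.2
    have h3 : (5 / 4 : ℝ) ^ (k + 1) * h = 5 / 4 * ((5 / 4) ^ k * h) := by ring
    have hr1 : 0 ≤ 1 - r := by linarith
    have hxr : 0 ≤ r * (1 - x) := mul_nonneg (by linarith) (by linarith)
    refine ⟨hRr r h1, le_max_of_le_right ?_, by linarith⟩
    -- `1 - (r + r²)/2 = (1 - r)(2 + r)/2 ≥ (5/4)(1 - r)` exactly when `r ≥ 1/2`: this fixes the
    -- ratio `5/4` and the condition on `r₀`.
    rw [h3]
    nlinarith [mul_nonneg hxr (by linarith : 0 ≤ r),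
      mul_nonneg hr1 (by linarith : 0 ≤ r - 1 / 2)]
  -- `(2N/h) · 5 = 40N/(1 - x)`; the piece next to 1 adds 2, whence 42.
  have hgeo : HasSum (fun k : ℕ => 2 * N / ((5 / 4) ^ k * h)) (40 * N / (1 - x)) := by
    have := (hasSum_geometric_of_lt_one (r := 4 / 5) (by norm_num) (by norm_num)).mul_left
      (2 * N / h)
    convert! this using 1
    · ext k
      have : (4 / 5 : ℝ) = (5 / 4)⁻¹ := by norm_num
      rw [this, inv_pow]
      field_simp
    · have : 1 - x ≠ 0 := by linarith
      rw [hh]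
      field_simp
      ring
  have htotal : ∫⁻ r in Ioo (0 : ℝ) 1, ‖G r‖ₑ ≤ ENNReal.ofReal
      (K * (∫ s in (0 : ℝ)..1, μ s) + 42 * N / (1 - x)) := by
    have hx1 : 0 < 1 - x := by linarith
    calc ∫⁻ r in Ioo (0 : ℝ) 1, ‖G r‖ₑ
        ≤ ∫⁻ r in (Ioo 0 r₀ ∪ Ico (max r₀ (1 - h)) 1) ∪ ⋃ k, S k, ‖G r‖ₑ :=
          lintegral_mono_set hcover
      _ ≤ (∫⁻ r in Ioo 0 r₀, ‖G r‖ₑ) + (∫⁻ r in Ico (max r₀ (1 - h)) 1, ‖G r‖ₑ)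
            + ∑' k, ∫⁻ r in S k, ‖G r‖ₑ :=
          (lintegral_union_le _ _ _).trans
            (add_le_add (lintegral_union_le _ _ _) (lintegral_iUnion_le _ _))
      _ ≤ ENNReal.ofReal (K * ∫ s in (0 : ℝ)..1, μ s) + ENNReal.ofReal (2 * N / (1 - x))
            + ∑' k : ℕ, ENNReal.ofReal (2 * N / ((5 / 4) ^ k * h)) :=
          add_le_add (add_le_add hsmall hfirst) (ENNReal.tsum_le_tsum hpiece)
      _ = _ := by
          rw [← ENNReal.ofReal_tsum_of_nonneg (fun k => by positivity) hgeo.summable,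
            hgeo.tsum_eq, ← ENNReal.ofReal_add (by positivity) (by positivity),
            ← ENNReal.ofReal_add (by positivity) (by positivity)]
          congr 1
          ring
  have hfin := (enorm_integral_le_lintegral_enorm (μ := volume.restrict (Ioo (0 : ℝ) 1)) G).trans
    htotal
  rw [← ofReal_norm] at hfin
  have hx1 : 0 < 1 - x := by linarith
  exact (ENNReal.ofReal_le_ofReal_iff (by positivity)).1 hfin

end IsRadialWeight

/-! ### Boundary limits and boundedness. -/

theorem eventually_toBoundary {P : ℂ → Prop} :
    (∀ᶠ z in toBoundary, P z) ↔ ∃ R < 1, ∀ z : ℂ, R < ‖z‖ → ‖z‖ < 1 → P z := by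
  rw [toBoundary, eventually_comap, Filter.Eventually, mem_nhdsLT_iff_exists_Ioo_subset]
  exact ⟨fun ⟨R, hR, h⟩ => ⟨R, hR, fun z h1 h2 => h ⟨h1, h2⟩ z rfl⟩,
    fun ⟨R, hR, h⟩ => ⟨R, hR, fun _ hb z hz => h z (hz ▸ hb.1) (hz ▸ hb.2)⟩⟩

theorem exists_norm_le_of_mem_holDisc {g : ℂ → ℂ} (hg : g ∈ HolDisc) {R : ℝ} (hR : R < 1) :
    ∃ M, 0 ≤ M ∧ ∀ z : ℂ, ‖z‖ ≤ R → ‖g z‖ ≤ M := by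
  have hc : ContinuousOn g (Metric.closedBall 0 R) :=
    (DifferentiableOn.continuousOn hg).mono (Metric.closedBall_subset_ball hR)
  obtain ⟨M, hM⟩ := (isCompact_closedBall (0 : ℂ) R).exists_bound_of_continuousOn hc
  exact ⟨max M 0, le_max_right _ _, fun z hz => (hM z (by simpa using hz)).trans (le_max_left _ _)⟩

theorem exists_mul_norm_le_of_tendsto {g : ℂ → ℂ} (hg : g ∈ HolDisc) {p : ℂ → ℝ} {A : ℝ}
    (hp : ∀ z ∈ disc, p z ≤ A)
    (h : Tendsto (fun z => p z * ‖g z‖) toBoundary (𝓝 0)) :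
    ∃ B, ∀ z ∈ disc, p z * ‖g z‖ ≤ B := by
  obtain ⟨R, hR, hR'⟩ := eventually_toBoundary.1 (h.eventually (ge_mem_nhds one_pos))
  obtain ⟨M, hM0, hM⟩ := exists_norm_le_of_mem_holDisc hg hR
  refine ⟨max 1 (|A| * M), fun z hz => ?_⟩
  rcases lt_or_ge R ‖z‖ with h1 | h1
  · exact (hR' z h1 (mem_disc.1 hz)).trans (le_max_left _ _)
  · refine le_max_of_le_right ?_
    exact mul_le_mul ((hp z hz).trans (le_abs_self A)) (hM z h1) (norm_nonneg _) (abs_nonneg A)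

theorem iSup_ofReal_lt_top {u : ℂ → ℝ} {B : ℝ} (h : ∀ z ∈ disc, u z ≤ B) :
    ⨆ z ∈ disc, ENNReal.ofReal (u z) < ∞ :=
  (iSup₂_le fun z hz => ENNReal.ofReal_le_ofReal (h z hz)).trans_lt ENNReal.ofReal_lt_top

theorem littleBlochSpace_subset : LittleBlochSpace ⊆ BlochSpace := by
  rintro f ⟨hf, h⟩
  obtain ⟨B, hB⟩ := exists_mul_norm_le_of_tendsto (A := 1) (deriv_mem_holDisc hf)
    (fun z _ => by nlinarith [norm_nonneg z]) h
  refine ⟨hf, ENNReal.add_lt_top.2 ⟨ENNReal.ofReal_lt_top, iSup_ofReal_lt_top (B := B) ?_⟩⟩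
  intro z hz
  refine le_trans ?_ (hB z hz)
  gcongr
  nlinarith [norm_nonneg z, mem_disc.1 hz]

/-! ### The embeddings. -/

namespace IsRadialWeight

variable {μ : ℝ → ℝ} (hμ : IsRadialWeight μ)
include hμ

theorem tail_le {z : ℂ} (hz : z ∈ disc) : tail μ z ≤ ∫ s in (0 : ℝ)..1, μ s :=
  hμ.integral_tail_anti le_rfl (norm_nonneg z) (mem_disc.1 hz).le

theorem tail_pos_of_mem {z : ℂ} (hz : z ∈ disc) : 0 < tail μ z :=
  hμ.tail_pos ‖z‖ ⟨norm_nonneg z, mem_disc.1 hz⟩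

theorem littleFracBlochSpace_subset : LittleFracBlochSpace μ ⊆ FracBlochSpace μ := by
  rintro f ⟨hf, h⟩
  obtain ⟨B, hB⟩ := exists_mul_norm_le_of_tendsto (hμ.fracDeriv_mem_holDisc hf)
    (fun z hz => hμ.tail_le hz) h
  exact ⟨hf, iSup_ofReal_lt_top hB⟩

theorem mul_norm_deriv_le {f : ℂ → ℂ} (hf : f ∈ HolDisc) {N : ℝ}
    (hN : ∀ z ∈ disc, tail μ z * ‖fracDeriv μ f z‖ ≤ N) {z : ℂ} (hz : z ∈ disc) :
    (1 - ‖z‖) * ‖deriv f z‖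
      ≤ (4 * (∫ s in (0 : ℝ)..1, μ s) / (∫ s in (1 / 2 : ℝ)..1, μ s) + 42) * N := by
  have hg := hμ.fracDeriv_mem_holDisc hf
  have h0 := hμ.tail_pos 0 ⟨le_rfl, one_pos⟩
  have h2 := hμ.tail_pos (1 / 2) ⟨by norm_num, by norm_num⟩
  have hN0 : 0 ≤ N := (mul_nonneg (hμ.tail_pos_of_mem hz).le (norm_nonneg _)).trans (hN z hz)
  have hz1 := mem_disc.1 hz
  have H : ∀ ρ : ℝ, 0 ≤ ρ → ρ < 1 → ∀ ζ : ℂ, ‖ζ‖ ≤ ρ →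
      ‖fracDeriv μ f ζ‖ ≤ N / ∫ s in ρ..1, μ s := by
    intro ρ hρ0 hρ1 ζ hζ
    have hζd : ζ ∈ disc := mem_disc.2 (hζ.trans_lt hρ1)
    rw [le_div_iff₀ (hμ.tail_pos ρ ⟨hρ0, hρ1⟩), mul_comm]
    refine le_trans ?_ (hN ζ hζd)
    gcongr
    exact hμ.integral_tail_anti (norm_nonneg ζ) hζ hρ1.le
  have hK : ∀ w : ℂ, ‖w‖ ≤ (1 / 2 : ℝ) ^ 2 → ‖deriv (fracDeriv μ f) w‖
      ≤ 4 * N / ∫ s in (1 / 2 : ℝ)..1, μ s := by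
    intro w hw
    have hd := norm_deriv_le_div_sub hg (w := w) (ρ := 1 / 2) (by linarith) (by norm_num)
      (H _ (by norm_num) (by norm_num))
    refine hd.trans ?_
    calc N / (∫ s in (1 / 2 : ℝ)..1, μ s) / (1 / 2 - ‖w‖)
        ≤ N / (∫ s in (1 / 2 : ℝ)..1, μ s) / (1 / 4) := by gcongr; linarith
      _ = 4 * N / ∫ s in (1 / 2 : ℝ)..1, μ s := by ring
  have hmain := hμ.norm_deriv_le hf hN0 H le_rfl (by norm_num) hK hz1 (by positivity)
  have hx : 0 < 1 - ‖z‖ := by linarith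
  set φ₀ := ∫ s in (0 : ℝ)..1, μ s
  set φ₂ := ∫ s in (1 / 2 : ℝ)..1, μ s
  calc (1 - ‖z‖) * ‖deriv f z‖
      ≤ (1 - ‖z‖) * (4 * N / φ₂ * φ₀ + 42 * N / (1 - ‖z‖)) := by gcongr
    _ = (1 - ‖z‖) * (4 * N / φ₂ * φ₀) + 42 * N := by field_simp
    _ ≤ 1 * (4 * N / φ₂ * φ₀) + 42 * N := by gcongr; linarith [norm_nonneg z]
    _ = (4 * φ₀ / φ₂ + 42) * N := by ring

theorem norm_apply_zero_eq (f : ℂ → ℂ) :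
    ‖f 0‖ = moment μ 1 / (∫ s in (0 : ℝ)..1, μ s) * (tail μ 0 * ‖fracDeriv μ f 0‖) := by
  have h0 := hμ.tail_pos 0 ⟨le_rfl, one_pos⟩
  have h1 := hμ.moment_pos 1
  have h2 : fracDeriv μ f 0 = f 0 / (moment μ 1 : ℂ) := by
    rw [fracDeriv, tsum_eq_single 0 (fun n hn => by simp [hn])]
    simp [coeff]
  rw [h2, tail, norm_zero, norm_div, Complex.norm_real, Real.norm_of_nonneg h1.le]
  field_simp

theorem exists_blochNorm_le : ∃ C : ℝ≥0, 0 < C ∧ ∀ f ∈ HolDisc,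
    blochNorm f ≤ (C : ℝ≥0∞) * fracBlochNorm μ f := by
  have h0 := hμ.tail_pos 0 ⟨le_rfl, one_pos⟩
  have h2 := hμ.tail_pos (1 / 2) ⟨by norm_num, by norm_num⟩
  have h1 := hμ.moment_pos 1
  set C₁ := moment μ 1 / (∫ s in (0 : ℝ)..1, μ s) with hC₁
  set C₂ := 4 * (∫ s in (0 : ℝ)..1, μ s) / (∫ s in (1 / 2 : ℝ)..1, μ s) + 42 with hC₂
  have hC₁0 : 0 < C₁ := by positivity
  have hC₂0 : 0 < C₂ := by positivity
  refine ⟨(C₁ + C₂).toNNReal, Real.toNNReal_pos.2 (by positivity), fun f hf => ?_⟩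
  change _ ≤ ENNReal.ofReal (C₁ + C₂) * _
  rcases eq_or_ne (fracBlochNorm μ f) ∞ with htop | htop
  · rw [htop, ENNReal.mul_top (ENNReal.ofReal_pos.2 (by positivity)).ne']
    exact le_top
  have hN : ∀ z ∈ disc, tail μ z * ‖fracDeriv μ f z‖ ≤ (fracBlochNorm μ f).toReal := fun z hz =>
    (ENNReal.ofReal_le_iff_le_toReal htop).1
      (le_iSup₂_of_le (f := fun z (_ : z ∈ disc) =>
        ENNReal.ofReal (tail μ z * ‖fracDeriv μ f z‖)) z hz le_rfl)
  rw [← ENNReal.ofReal_toReal htop, ← ENNReal.ofReal_mul (by positivity), add_mul,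
    ENNReal.ofReal_add (by positivity) (by positivity), blochNorm]
  refine add_le_add (ENNReal.ofReal_le_ofReal ?_) (iSup₂_le fun z hz => ENNReal.ofReal_le_ofReal
    (hμ.mul_norm_deriv_le hf hN hz))
  rw [hμ.norm_apply_zero_eq f, ← hC₁]
  exact mul_le_mul_of_nonneg_left (hN 0 (mem_disc.2 (by simp))) hC₁0.le

/-- Near the boundary this is the little-o condition and monotonicity of the tail; on a fixed
compact disc `D^μ f` is bounded, while `ε / μ̂(ρ) → ∞` as `ρ → 1`. -/
theorem exists_norm_fracDeriv_le_div {f : ℂ → ℂ} (hf : f ∈ LittleFracBlochSpace μ) {ε : ℝ}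
    (hε : 0 < ε) : ∃ R < 1, ∀ ρ, R ≤ ρ → ρ < 1 → ∀ ζ : ℂ, ‖ζ‖ ≤ ρ →
      ‖fracDeriv μ f ζ‖ ≤ ε / ∫ s in ρ..1, μ s := by
  obtain ⟨R₁, hR₁, h1⟩ := eventually_toBoundary.1 (hf.2.eventually (ge_mem_nhds hε))
  obtain ⟨M, hM0, hM⟩ := exists_norm_le_of_mem_holDisc (hμ.fracDeriv_mem_holDisc hf.1) hR₁
  have ht : Tendsto (fun r => M * ∫ s in r..1, μ s) (𝓝[<] 1) (𝓝 0) := by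
    simpa using hμ.tendsto_integral_tail.const_mul M
  obtain ⟨R₂, hR₂, h2⟩ := mem_nhdsLT_iff_exists_Ioo_subset.1 (ht.eventually (ge_mem_nhds hε))
  have hR₂' : R₂ < 1 := hR₂
  refine ⟨max ((R₂ + 1) / 2) 0, max_lt (by linarith) one_pos, fun ρ hρ hρ1 ζ hζ => ?_⟩
  have hρ0 : 0 ≤ ρ := (le_max_right _ _).trans hρ
  have hρ2 : R₂ < ρ := lt_of_lt_of_le (by linarith) ((le_max_left _ _).trans hρ)
  have hT := hμ.tail_pos ρ ⟨hρ0, hρ1⟩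
  rw [le_div_iff₀ hT]
  rcases lt_or_ge R₁ ‖ζ‖ with h3 | h3
  · refine le_trans ?_ (h1 ζ h3 (hζ.trans_lt hρ1))
    rw [mul_comm]
    gcongr
    exact hμ.integral_tail_anti (norm_nonneg ζ) hζ hρ1.le
  · exact (mul_le_mul_of_nonneg_right (hM ζ h3) hT.le).trans (h2 ⟨hρ2, hρ1⟩)

theorem littleFracBlochSpace_subset_littleBlochSpace :
    LittleFracBlochSpace μ ⊆ LittleBlochSpace := by
  intro f hf
  refine ⟨hf.1, ?_⟩
  rw [Metric.tendsto_nhds]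
  intro ε hε
  -- `168 = 4 · 42`: after `1 - |z|² ≤ 2(1 - |z|)` the main term is `ε/2`, and the term with `K` is
  -- at most `ε/4`.
  obtain ⟨R, hR, H⟩ := hμ.exists_norm_fracDeriv_le_div hf (by positivity : 0 < ε / 168)
  -- With `r² = q > R`, the requirement `R ≤ r²|z|` holds as soon as `|z| > R/q`, and `R/q < 1`.
  obtain ⟨q, hq, hq1⟩ := exists_between (max_lt (by norm_num : (1 / 2 : ℝ) < 1)
    (max_lt hR one_pos : max R 0 < 1))
  set r := Real.sqrt q with hr
  have hq0 : 0 < q := lt_of_le_of_lt (by positivity) hq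
  have hrsq : r ^ 2 = q := Real.sq_sqrt hq0.le
  have hr_lt : r < 1 := by rw [hr, Real.sqrt_lt' one_pos]; simpa using hq1
  have hr_pos : 0 < r := Real.sqrt_pos.2 hq0
  have hr_half : 1 / 2 ≤ r := by
    have : (1 / 2 : ℝ) < q := (le_max_left _ _).trans_lt hq
    nlinarith
  have hRq : R < q := (le_max_of_le_right (le_max_left _ _)).trans_lt hq
  obtain ⟨K, hK0, hK⟩ := exists_norm_le_of_mem_holDisc
    (deriv_mem_holDisc (hμ.fracDeriv_mem_holDisc hf.1)) (R := r ^ 2) (by rwa [hrsq])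
  have hφ := hμ.tail_pos 0 ⟨le_rfl, one_pos⟩
  set φ₀ := ∫ s in (0 : ℝ)..1, μ s
  refine eventually_toBoundary.2
    ⟨max (R / q) (1 - ε / (8 * (K * φ₀ + 1))), max_lt ((div_lt_one hq0).2 hRq) ?_, ?_⟩
  · have : 0 < ε / (8 * (K * φ₀ + 1)) := by positivity
    linarith
  intro z hz1 hz
  have hzR : R ≤ r ^ 2 * ‖z‖ := by
    have := (le_max_left _ _).trans_lt hz1
    rw [div_lt_iff₀ hq0] at this
    rw [hrsq]
    linarith
  have hzε : (1 - ‖z‖) * (K * φ₀) ≤ ε / 8 := by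
    have h1 : 1 - ‖z‖ ≤ ε / (8 * (K * φ₀ + 1)) := by
      linarith [(le_max_right _ _).trans_lt hz1]
    rw [le_div_iff₀ (by positivity)] at h1
    linarith
  have hx : 0 < 1 - ‖z‖ := by linarith
  have hmain := hμ.norm_deriv_le hf.1 (by positivity) H hr_half hr_lt hK hz hzR
  have hfac : 1 - ‖z‖ ^ 2 ≤ 2 * (1 - ‖z‖) := by nlinarith [norm_nonneg z]
  have hnn : 0 ≤ 1 - ‖z‖ ^ 2 := by nlinarith [norm_nonneg z]
  rw [Real.dist_eq, sub_zero, abs_of_nonneg (by positivity)]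
  calc (1 - ‖z‖ ^ 2) * ‖deriv f z‖
      ≤ 2 * (1 - ‖z‖) * (K * φ₀ + 42 * (ε / 168) / (1 - ‖z‖)) := by gcongr
    _ = 2 * ((1 - ‖z‖) * (K * φ₀)) + ε / 2 := by field_simp; ring
    _ < ε := by linarith

end IsRadialWeight

end FracBloch

theorem theorem1 (μ : ℝ → ℝ) (hμ : FracBloch.IsRadialWeight μ) :
    (FracBloch.FracBlochSpace μ ⊆ FracBloch.BlochSpace ∧
      ∃ C : ℝ≥0, 0 < C ∧ ∀ f ∈ FracBloch.HolDisc,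
        FracBloch.blochNorm f ≤ (C : ℝ≥0∞) * FracBloch.fracBlochNorm μ f) ∧
    (FracBloch.LittleFracBlochSpace μ ⊆ FracBloch.FracBlochSpace μ ∧
      FracBloch.LittleBlochSpace ⊆ FracBloch.BlochSpace ∧
      FracBloch.LittleFracBlochSpace μ ⊆ FracBloch.LittleBlochSpace ∧
      ∃ C : ℝ≥0, 0 < C ∧ ∀ f ∈ FracBloch.LittleFracBlochSpace μ,
        FracBloch.blochNorm f ≤ (C : ℝ≥0∞) * FracBloch.fracBlochNorm μ f) := by
  obtain ⟨C, hC, hCf⟩ := hμ.exists_blochNorm_le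
  exact ⟨⟨fun f hf => ⟨hf.1, (hCf f hf.1).trans_lt (ENNReal.mul_lt_top ENNReal.coe_lt_top hf.2)⟩,
      C, hC, hCf⟩,
    hμ.littleFracBlochSpace_subset, FracBloch.littleBlochSpace_subset,
    hμ.littleFracBlochSpace_subset_littleBlochSpace, C, hC, fun f hf => hCf f hf.1⟩
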